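/- For a positive integer $N$, let $J_N$ denote the number of sign vectors $(\delta_0,\dots,\delta_N)\in\{-1,1\}^{N+1}$ such that $\sum_{i=0}^{N}\delta_i\binom{N}{i}=0$. If $N=2^n$ with $n\ge 3$, then $$J_N\;\le\; 0.3258\cdot 2^{\,3\cdot 2^{n-2}-2^{(n-3)/2}} .$$ -/

import Mathlib

/-- The set of all sign vectors `[δ_0, …, δ_n]`, `δ_i ∈ {-1, 1}`, that satisfy
`∑ i, δ_i * (n choose i) = 0`, i.e. the solutions of the binomial coefficients bisection problem. -/
def bisectionSolutions (n : ℕ) : Finset (Fin (n + 1) → ℤ) :=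
  (Fintype.piFinset fun _ : Fin (n + 1) => ({-1, 1} : Finset ℤ)).filter
    fun δ => ∑ i : Fin (n + 1), δ i * (n.choose (i : ℕ) : ℤ) = 0

/-- The number of solutions of the binomial coefficients bisection problem. -/
def bisectionCount (n : ℕ) : ℕ := (bisectionSolutions n).card

/-! In the lower third of the row the binomial coefficients at least double, so each exceeds the sum
of its predecessors and their signs are forced by the remaining ones (`bisectionCount_le_two_pow`).
This leaves about `2N/3` free signs, below the required `3N/4 - √(N/8)` with room to spare once `n ≥
6`. For `n = 3, 4, 5` that room is missing, and the solutions are counted by kernel evaluation of a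
pruned recursion. -/

/-! ### Counting signed sums along a list -/

/-- The number of sign choices for the entries of the list for which the signed sum equals `s`. -/
def signedSumCount : List ℕ → ℤ → ℕ
  | [], s => if s = 0 then 1 else 0
  | a :: l, s => signedSumCount l (s - a) + signedSumCount l (s + a)

/-- A version of `signedSumCount` that abandons targets exceeding the sum of the list. -/
def prunedSignedSumCount : List ℕ → ℤ → ℕ
  | [], s => if s = 0 then 1 else 0
  | a :: l, s =>
    if a + l.sum < s.natAbs then 0
    else prunedSignedSumCount l (s - a) + prunedSignedSumCount l (s + a)

theorem signedSumCount_perm {l l' : List ℕ} (h : l.Perm l') (s : ℤ) :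
    signedSumCount l s = signedSumCount l' s := by
  induction h generalizing s with
  | nil => rfl
  | cons a _ ih => simp only [signedSumCount, ih]
  | swap a b l =>
    simp only [signedSumCount]
    rw [show s - (b : ℤ) - a = s - a - b by ring, show s - (b : ℤ) + a = s + a - b by ring,
      show s + (b : ℤ) - a = s - a + b by ring, show s + (b : ℤ) + a = s + a + b by ring]
    ring
  | trans _ _ ih₁ ih₂ => rw [ih₁, ih₂]

theorem signedSumCount_eq_zero {l : List ℕ} {s : ℤ} (h : l.sum < s.natAbs) :
    signedSumCount l s = 0 := by
  induction l generalizing s with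
  | nil =>
    have : s ≠ 0 := by rintro rfl; simp at h
    simp [signedSumCount, this]
  | cons a l ih =>
    rw [List.sum_cons] at h
    rw [signedSumCount, ih (by omega), ih (by omega)]

theorem prunedSignedSumCount_eq (l : List ℕ) (s : ℤ) :
    prunedSignedSumCount l s = signedSumCount l s := by
  induction l generalizing s with
  | nil => rfl
  | cons a l ih =>
    rw [prunedSignedSumCount]
    split_ifs with h
    · exact (signedSumCount_eq_zero (by simpa using h)).symm
    · rw [signedSumCount, ih, ih]

theorem card_signVectors_le_signedSumCount (k : ℕ) (a : Fin k → ℕ) (s : ℤ) :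
    ((Fintype.piFinset fun _ : Fin k => ({-1, 1} : Finset ℤ)).filter
      fun δ => ∑ i, δ i * (a i : ℤ) = s).card ≤ signedSumCount (List.ofFn a) s := by
  induction k generalizing s with
  | zero =>
    rw [List.ofFn_zero, signedSumCount]
    split_ifs with h
    · exact (Finset.card_filter_le _ _).trans (by simp)
    · simp [Ne.symm h]
  | succ k ih =>
    rw [List.ofFn_succ, signedSumCount]
    set T : ℤ → Finset (Fin k → ℤ) := fun t =>
      (Fintype.piFinset fun _ : Fin k => ({-1, 1} : Finset ℤ)).filter
        fun δ => ∑ i, δ i * (a i.succ : ℤ) = t with hT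
    have hsub : ((Fintype.piFinset fun _ : Fin (k + 1) => ({-1, 1} : Finset ℤ)).filter
        fun δ => ∑ i, δ i * (a i : ℤ) = s) ⊆
        (T (s - a 0)).image (fun δ => (Fin.cons 1 δ : Fin (k + 1) → ℤ)) ∪
          (T (s + a 0)).image (fun δ => (Fin.cons (-1) δ : Fin (k + 1) → ℤ)) := by
      intro δ hδ
      simp only [Finset.mem_filter, Fintype.mem_piFinset, Finset.mem_insert,
        Finset.mem_singleton, Fin.sum_univ_succ] at hδ
      obtain ⟨hδ, hs⟩ := hδ
      simp only [hT, Finset.mem_union, Finset.mem_image, Finset.mem_filter,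
        Fintype.mem_piFinset, Finset.mem_insert, Finset.mem_singleton]
      rcases hδ 0 with h0 | h0
      · refine Or.inr ⟨Fin.tail δ, ⟨fun i => hδ i.succ, ?_⟩, ?_⟩
        · rw [h0] at hs
          simp only [Fin.tail]
          linarith
        · rw [← h0, Fin.cons_self_tail]
      · refine Or.inl ⟨Fin.tail δ, ⟨fun i => hδ i.succ, ?_⟩, ?_⟩
        · rw [h0] at hs
          simp only [Fin.tail]
          linarith
        · rw [← h0, Fin.cons_self_tail]
    calc _ ≤ _ := Finset.card_le_card hsub
      _ ≤ _ := Finset.card_union_le _ _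
      _ ≤ _ := add_le_add (Finset.card_image_le.trans (ih _ _))
        (Finset.card_image_le.trans (ih _ _))

/-- The order is left free so that the list can be sorted decreasingly: with large entries first,
pruning cuts most branches early. -/
theorem bisectionCount_le_prunedSignedSumCount {N : ℕ} {l : List ℕ}
    (h : (List.ofFn fun i : Fin (N + 1) => N.choose i).Perm l) :
    bisectionCount N ≤ prunedSignedSumCount l 0 := by
  rw [prunedSignedSumCount_eq, ← signedSumCount_perm h]
  exact card_signVectors_le_signedSumCount (N + 1) (fun i => N.choose i) 0

theorem bisectionCount_eight_le : bisectionCount 8 ≤ 6 :=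
  (bisectionCount_le_prunedSignedSumCount
    (List.perm_insertionSort (· ≥ ·) _).symm).trans (by decide +kernel)

theorem bisectionCount_sixteen_le : bisectionCount 16 ≤ 2 :=
  (bisectionCount_le_prunedSignedSumCount
    (List.perm_insertionSort (· ≥ ·) _).symm).trans (by decide +kernel)

theorem bisectionCount_thirtyTwo_le : bisectionCount 32 ≤ 6 :=
  (bisectionCount_le_prunedSignedSumCount
    (List.perm_insertionSort (· ≥ ·) _).symm).trans (by decide +kernel)

/-! ### Sequences that at least double -/

theorem sum_range_lt_of_two_mul_le {a : ℕ → ℤ} {m : ℕ} (h0 : 0 < a 0)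
    (h : ∀ i < m, 2 * a i ≤ a (i + 1)) {j : ℕ} (hj : j ≤ m) :
    ∑ i ∈ Finset.range j, a i < a j := by
  induction j with
  | zero => simpa using h0
  | succ j ih =>
    rw [Finset.sum_range_succ]
    linarith [ih (by omega), h j (by omega)]

/-- Signed sums of a sequence that at least doubles determine the signs: `d` plays the role of
the difference of two sign vectors. -/
theorem eq_zero_of_sum_mul_eq_zero {a d : ℕ → ℤ} {m : ℕ} (ha : ∀ i, 0 ≤ a i) (h0 : 0 < a 0)
    (h : ∀ i < m, 2 * a i ≤ a (i + 1)) (hd : ∀ i, d i = -2 ∨ d i = 0 ∨ d i = 2) {j : ℕ}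
    (hj : j ≤ m + 1) (hs : ∑ i ∈ Finset.range j, d i * a i = 0) : ∀ i < j, d i = 0 := by
  induction j with
  | zero => intro i hi; omega
  | succ j ih =>
    rw [Finset.sum_range_succ] at hs
    have hlt := sum_range_lt_of_two_mul_le h0 h (j := j) (by omega)
    have habs : |∑ i ∈ Finset.range j, d i * a i| ≤ 2 * ∑ i ∈ Finset.range j, a i := by
      rw [Finset.mul_sum]
      refine (Finset.abs_sum_le_sum_abs _ _).trans (Finset.sum_le_sum fun i _ => ?_)
      rw [abs_mul, abs_of_nonneg (ha i)]
      refine mul_le_mul_of_nonneg_right ?_ (ha i)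
      rcases hd i with e | e | e <;> simp [e]
    rw [abs_le] at habs
    -- Otherwise the top term has size `2 * a j`, too large for the lower terms to cancel.
    have hdj : d j = 0 := by
      rcases hd j with e | e | e
      · rw [e] at hs; linarith
      · exact e
      · rw [e] at hs; linarith
    intro i hi
    rcases Nat.lt_succ_iff_lt_or_eq.mp hi with hi | rfl
    · exact ih (by omega) (by simpa [hdj] using hs) i hi
    · exact hdj

/-- The ratio of consecutive coefficients is `(N - i) / (i + 1)`. -/
theorem two_mul_choose_le_choose_succ {N i : ℕ} (h : 3 * i + 2 ≤ N) :
    2 * N.choose i ≤ N.choose (i + 1) := by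
  have key := Nat.choose_succ_right_eq N i
  refine Nat.le_of_mul_le_mul_right (c := i + 1) ?_ (by omega)
  rw [key, show 2 * N.choose i * (i + 1) = N.choose i * (2 * (i + 1)) by ring]
  exact Nat.mul_le_mul_left _ (by omega)

/-- The signs of the binomial coefficients up to index `m` are determined by the others. -/
theorem bisectionCount_le_two_pow {N m : ℕ} (hm : 3 * m ≤ N + 1) (hmN : m ≤ N) :
    bisectionCount N ≤ 2 ^ (N - m) := by
  have hcard : (Fintype.piFinset fun _ : Fin (N - m) => ({-1, 1} : Finset ℤ)).card
      = 2 ^ (N - m) := by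
    rw [Fintype.card_piFinset_const]
    rfl
  rw [← hcard, bisectionCount]
  refine Finset.card_le_card_of_injOn
    (fun δ j => δ ⟨m + 1 + j, by omega⟩) ?_ ?_
  · intro δ hδ
    simp only [bisectionSolutions, Finset.coe_filter, Set.mem_ofPred_eq,
      Fintype.mem_piFinset] at hδ
    simp only [Finset.mem_coe, Fintype.mem_piFinset]
    exact fun j => hδ.1 _
  · intro δ hδ δ' hδ' heq
    simp only [bisectionSolutions, Finset.coe_filter, Set.mem_ofPred_eq, Fintype.mem_piFinset,
      Finset.mem_insert, Finset.mem_singleton] at hδ hδ'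
    let d : ℕ → ℤ := fun i => if h : i < N + 1 then δ ⟨i, h⟩ - δ' ⟨i, h⟩ else 0
    have hd : ∀ i, d i = -2 ∨ d i = 0 ∨ d i = 2 := by
      intro i
      by_cases h : i < N + 1
      · simp only [d, h, dif_pos]
        have h1 := hδ.1 ⟨i, h⟩
        have h2 := hδ'.1 ⟨i, h⟩
        omega
      · exact Or.inr (Or.inl (dif_neg h))
    have hlarge : ∀ i, m < i → d i = 0 := by
      intro i hi
      by_cases h : i < N + 1
      · have := congrFun heq ⟨i - (m + 1), by omega⟩
        simp only [show m + 1 + (i - (m + 1)) = i by omega] at this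
        simp [d, this]
      · exact dif_neg h
    have hsum : ∑ i ∈ Finset.range (N + 1), d i * (N.choose i : ℤ) = 0 := by
      rw [Finset.sum_range]
      simp only [d, Fin.is_lt, dif_pos, Fin.eta, sub_mul, Finset.sum_sub_distrib]
      rw [hδ.2, hδ'.2, sub_zero]
    have hsum' : ∑ i ∈ Finset.range (m + 1), d i * (N.choose i : ℤ) = 0 := by
      rw [← hsum]
      refine Finset.sum_subset (Finset.range_mono (by omega)) fun i _ hi => ?_
      rw [hlarge i (by simpa using hi), zero_mul]
    have hsmall := eq_zero_of_sum_mul_eq_zero (a := fun i => (N.choose i : ℤ)) (m := m)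
      (fun i => by positivity) (by simp)
      (fun i hi => by exact_mod_cast two_mul_choose_le_choose_succ (by omega))
      hd le_rfl hsum'
    funext i
    have hi : d i = 0 := by
      rcases Nat.lt_or_ge m i with h | h
      · exact hlarge _ h
      · exact hsmall _ (by omega)
    simp only [d, Fin.is_lt, dif_pos, Fin.eta] at hi
    omega

/-! ### The main bound -/

theorem bisectionCount_two_pow_le_of_six_le (n : ℕ) (hn : 6 ≤ n) :
    (bisectionCount (2 ^ n) : ℝ) ≤
      0.3258 * (2 : ℝ) ^ (3 * (2 : ℝ) ^ ((n : ℝ) - 2) - (2 : ℝ) ^ (((n : ℝ) - 3) / 2)) := by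
  set x : ℝ := (2 : ℝ) ^ (((n : ℝ) - 3) / 2) with hx
  have hx0 : 0 < x := by positivity
  have hxx : x ^ 2 = (2 : ℝ) ^ ((n : ℝ) - 3) := by
    rw [hx, ← Real.rpow_natCast, ← Real.rpow_mul (by norm_num)]
    congr 1
    push_cast
    ring
  have hN2 : (2 : ℝ) ^ ((n : ℝ) - 2) = 2 * x ^ 2 := by
    rw [hxx, show (n : ℝ) - 2 = (n - 3) + 1 by ring, Real.rpow_add_one (by norm_num)]
    ring
  have hN : (2 : ℝ) ^ n = 8 * x ^ 2 := by
    rw [hxx, ← Real.rpow_natCast, show (n : ℝ) = (n - 3) + (3 : ℕ) by push_cast; ring,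
      Real.rpow_add_natCast (by norm_num)]
    norm_num
    ring
  have hx8 : 8 ≤ x ^ 2 := by
    have : (2 : ℝ) ^ 6 ≤ 2 ^ n := pow_le_pow_right₀ (by norm_num) hn
    rw [hN] at this
    linarith
  have hx28 : 2.8 ≤ x := by nlinarith
  obtain ⟨m, hm⟩ : ∃ m, m = (2 ^ n + 1) / 3 := ⟨_, rfl⟩
  have hpos : 0 < 2 ^ n := by positivity
  have hmN : m ≤ 2 ^ n := by omega
  have hcount : (bisectionCount (2 ^ n) : ℝ) ≤ (2 : ℝ) ^ (((2 ^ n - m : ℕ)) : ℝ) := by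
    rw [Real.rpow_natCast]
    exact_mod_cast bisectionCount_le_two_pow (by omega) hmN
  have hm3 : (2 : ℝ) ^ n ≤ 3 * m + 1 := by
    have : 2 ^ n ≤ 3 * m + 1 := by omega
    exact_mod_cast this
  -- This amounts to `2x² - 3x - 7 ≥ 0`, true from `x = 2.8` on. The spare `-2` yields the factor
  -- `1/4 ≤ 0.3258`.
  have hexp : ((2 ^ n - m : ℕ) : ℝ) ≤ -2 + (3 * (2 * x ^ 2) - x) := by
    rw [Nat.cast_sub hmN]
    push_cast
    rw [hN] at hm3 ⊢
    nlinarith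
  rw [hN2]
  calc (bisectionCount (2 ^ n) : ℝ) ≤ _ := hcount
    _ ≤ (2 : ℝ) ^ (-2 + (3 * (2 * x ^ 2) - x)) :=
      Real.rpow_le_rpow_of_exponent_le (by norm_num) hexp
    _ = (2 : ℝ) ^ (-2 : ℝ) * (2 : ℝ) ^ (3 * (2 * x ^ 2) - x) := Real.rpow_add (by norm_num) _ _
    _ ≤ _ := by
      refine mul_le_mul_of_nonneg_right ?_ (by positivity)
      rw [Real.rpow_neg (by norm_num)]
      norm_num

theorem le_mul_two_rpow_sub {a b c x : ℝ} {k : ℕ} (hx : x ≤ c) (hk : (k : ℝ) + c ≤ b)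
    (ha : a ≤ 0.3258 * 2 ^ k) : a ≤ 0.3258 * (2 : ℝ) ^ (b - x) := by
  refine ha.trans (mul_le_mul_of_nonneg_left ?_ (by norm_num))
  rw [← Real.rpow_natCast]
  exact Real.rpow_le_rpow_of_exponent_le (by norm_num) (by linarith)

theorem mainTheorem4 (n : ℕ) (hn : 3 ≤ n) :
    (bisectionCount (2 ^ n) : ℝ) ≤
      0.3258 * (2 : ℝ) ^ (3 * (2 : ℝ) ^ ((n : ℝ) - 2) - (2 : ℝ) ^ (((n : ℝ) - 3) / 2)) := by
  rcases Nat.lt_or_ge n 6 with h | h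
  · have hx : (2 : ℝ) ^ (((n : ℝ) - 3) / 2) ≤ 2 := by
      refine (Real.rpow_le_rpow_of_exponent_le (y := ((n : ℝ) - 3) / 2) (z := 1)
        (by norm_num) ?_).trans (by norm_num)
      have : (n : ℝ) ≤ 5 := by exact_mod_cast Nat.le_of_lt_succ h
      linarith
    interval_cases n
    -- Here `hx` is too weak: `0.3258 * 2 ^ 4 < 6`, so the exact value `1` is used.
    · refine le_mul_two_rpow_sub (k := 5) (c := 1) (by norm_num) (by norm_num) ?_
      have : (bisectionCount (2 ^ 3) : ℝ) ≤ 6 := Nat.cast_le_ofNat.mpr bisectionCount_eight_le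
      exact this.trans (by norm_num)
    · refine le_mul_two_rpow_sub (k := 10) hx (by norm_num) ?_
      have : (bisectionCount (2 ^ 4) : ℝ) ≤ 2 := Nat.cast_le_ofNat.mpr bisectionCount_sixteen_le
      exact this.trans (by norm_num)
    · refine le_mul_two_rpow_sub (k := 22) hx (by norm_num) ?_
      have : (bisectionCount (2 ^ 5) : ℝ) ≤ 6 := Nat.cast_le_ofNat.mpr bisectionCount_thirtyTwo_le
      exact this.trans (by norm_num)
  · exact bisectionCount_two_pow_le_of_six_le n h
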